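/- **Conventions.** A frame is a complete lattice $L$ with $a\wedge\bigvee B=\bigvee\{a\wedge b\mid b\in B\}$ for all $a\in L$, $B\subseteq L$; its least and greatest elements are $0$ and $1$, and $\to$ is its Heyting implication. A prime of $L$ is an element $p\neq 1$ such that $p=x\wedge y$ implies $p=x$ or $p=y$; a covered prime is an element $p\ne 1$ such that $p=\bigwedge_{i} x_i$ implies $p=x_i$ for some $i$. Write $\mathsf{pt}_D(L)$ for the set of covered primes of $L$ and $\mathsf{pt}({\uparrow}a)$ for the set of primes $p$ of $L$ with $a\le p$. If $a=\bigwedge\mathsf{pt}({\uparrow}a)$, then $p\in\mathsf{pt}({\uparrow}a)$ is an essential prime of $a$ if $\bigwedge(\mathsf{pt}({\uparrow}a)\setminus{\uparrow}p)\ne a$, and an absolutely essential prime of $a$ if $\bigwedge(\mathsf{pt}({\uparrow}a)\setminus\{p\})\neq a$; if $a\neq\bigwedge\mathsf{pt}({\uparrow}a)$, then $a$ has no (absolutely) essential primes. A frame is spatial if it is isomorphic to the frame of open sets of some topological space, and strongly $T_D$-spatial if it is spatial and all its primes are covered. A sublocale of $L$ is a subset $S\subseteq L$ closed under arbitrary meets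 and such that $a\to s\in S$ for all $a\in L$, $s\in S$; it is a frame in the order inherited from $L$. The sublocales of $L$ ordered by inclusion form a coframe $\mathsf{S}(L)$, whose least element is the zero sublocale $\{1\}$. A coframe is spatial if its order dual is a spatial frame, and Boolean if each of its elements has a complement. $L$ is totally spatial if all its sublocales are spatial frames. **Theorem.** For a frame $L$, the following are equivalent. 1. $L$ is totally spatial and all its primes are covered. 2. $L$ is totally spatial and strongly $T_D$-spatial. 3. All sublocales of $L$ are strongly $T_D$-spatial. 4. There is an isomorphism of partially ordered sets $\mathsf{S}(L)\cong\mathcal{P}(\mathsf{pt}_D(L))$. 5. The coframe $\mathsf{S}(L)$ is spatial and Boolean. 6. Every element $a$ of $L$ is the meet of those essential primes of $a$ that are covered primes of $L$. 7. Every element $a$ of $L$ is the meet of those absolutely essential primes of $a$ that are covered primes of $L$. 8. $L$ is spatial and every element $a\neq 1$ of $L$ has an absolutely essential prime that is a covered prime of $L$. 9. Every nonzero sublocale of $L$ contains a covered prime of $L$. -/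

import Mathlib

namespace FrameTD

universe u

/-- A prime of a frame: an element `p ≠ 1` such that `p = x ⊓ y` implies `p = x` or `p = y`. -/
def IsPrimeElement {L : Type u} [Order.Frame L] (p : L) : Prop :=
  p ≠ ⊤ ∧ ∀ x y : L, p = x ⊓ y → p = x ∨ p = y

/-- A covered prime of a frame: an element `p ≠ 1` such that whenever `p` is the meet of an
arbitrary family, `p` is a member of that family. -/
def IsCoveredPrime {L : Type u} [Order.Frame L] (p : L) : Prop :=
  p ≠ ⊤ ∧ ∀ A : Set L, p = sInf A → p ∈ A

/-- The set `pt_D(L)` of covered primes of `L`. -/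
def ptD (L : Type u) [Order.Frame L] : Set L :=
  {p | IsCoveredPrime p}

/-- All primes of `L` are covered. -/
def AllPrimesCovered (L : Type u) [Order.Frame L] : Prop :=
  ∀ p : L, IsPrimeElement p → IsCoveredPrime p

/-- A frame is spatial if it is isomorphic to the frame of open sets of a topological space. -/
def IsSpatial (L : Type u) [Order.Frame L] : Prop :=
  ∃ (X : Type u) (_ : TopologicalSpace X), Nonempty (L ≃o TopologicalSpace.Opens X)

/-- A frame is strongly `T_D`-spatial if it is spatial and all its primes are covered. -/
def IsStronglyTDSpatial (L : Type u) [Order.Frame L] : Prop :=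
  IsSpatial L ∧ AllPrimesCovered L

/-- A frame is totally spatial if each of its sublocales, viewed as a frame, is spatial. -/
def IsTotallySpatial (L : Type u) [Order.Frame L] : Prop :=
  ∀ S : Sublocale L, IsSpatial S

/-- A coframe is spatial if its order dual is a spatial frame. -/
def IsSpatialCoframe (C : Type u) [Order.Coframe C] : Prop :=
  IsSpatial Cᵒᵈ

/-- The set `pt(↑a)` of primes of `L` above `a`. -/
def primesAbove {L : Type u} [Order.Frame L] (a : L) : Set L :=
  {p | IsPrimeElement p ∧ a ≤ p}

/-- `p` is an essential prime of `a`, where `a` is the meet of the primes above it: the meet of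
`pt(↑a) \ ↑p` differs from `a`. -/
def IsEssentialPrime {L : Type u} [Order.Frame L] (p a : L) : Prop :=
  a = sInf (primesAbove a) ∧ p ∈ primesAbove a ∧ sInf (primesAbove a \ Set.Ici p) ≠ a

/-- `p` is an absolutely essential prime of `a`, where `a` is the meet of the primes above it:
the meet of `pt(↑a) \ {p}` differs from `a`. -/
def IsAbsolutelyEssentialPrime {L : Type u} [Order.Frame L] (p a : L) : Prop :=
  a = sInf (primesAbove a) ∧ p ∈ primesAbove a ∧ sInf (primesAbove a \ {p}) ≠ a

end FrameTD

/-!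
# Frames all of whose sublocales are strongly `T_D`-spatial

For an element `a` of a frame, `{x ⇨ a | x}` is the least sublocale containing `a`; for a prime `p`
it is `{p, ⊤}`. Every condition is compared with the last one, that each nonzero sublocale contains
a covered prime.

Assume that condition, let `a ∈ L`, and let `m` be the meet of the covered primes in the least
sublocale containing `a`. If `m ≰ a`, then `m ⇨ a ≠ ⊤`, and the least sublocale containing `m ⇨ a`
contains a covered prime `(x ⊓ m) ⇨ a`. That prime lies above `m`, which forces it to be `⊤`. Hence
every `a` is the meet of the covered primes in its least sublocale
(`eq_sInf_covered_mem_principalSublocale`). Consequently a sublocale is determined by its covered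
primes, it is spatial, and its primes, which are primes of `L`, are covered.

Essentiality is membership in the least sublocale. If `a = m ⊓ p` with `p` prime and `m ≠ a`, then
`m ⇨ a = p`, so an essential prime of `a` belongs to each sublocale containing `a`
(`IsPrimeElement.mem_of_inf_mem`). Conversely a covered prime `p = x ⇨ a` cannot be omitted from a
representation of `a` as a meet of primes `q`: the meet `p` of the elements `x ⇨ q ∈ {q, ⊤}` is
attained by one of them (`IsCoveredPrime.mem_of_eq_sInf`).

Finally, suppose that the coframe of sublocales is spatial and Boolean. Its dual has enough primes,
and these are coatoms, so each nonzero sublocale contains an atom. An atom has the form `{p, ⊤}`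
with `p` prime. Every element of `L` is a meet of an element of the atom and one of its complement,
so a family not containing `p` with meet `p` would lie in the complement, and `p` with it
(`isCoveredPrime_of_isAtom`).
-/

namespace FrameTD

universe u

variable {L : Type u} [Order.Frame L]

/-! ### Primes and covered primes -/

theorem IsCoveredPrime.isPrimeElement {p : L} (hp : IsCoveredPrime p) : IsPrimeElement p := by
  refine ⟨hp.1, fun x y h => ?_⟩
  have := hp.2 {x, y} (by rw [sInf_pair]; exact h)
  simpa using this

theorem IsPrimeElement.himp_eq {p : L} (hp : IsPrimeElement p) {x : L} (hx : ¬ x ≤ p) :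
    x ⇨ p = p := by
  have h : p = (p ⊔ x) ⊓ (p ⊔ (x ⇨ p)) := by
    rw [← sup_inf_left, inf_himp, sup_eq_left.2 inf_le_right]
  rcases hp.2 _ _ h with h | h
  · exact absurd (sup_eq_left.1 h.symm) hx
  · exact le_antisymm (sup_eq_left.1 h.symm) le_himp

theorem IsPrimeElement.himp_eq_or_eq_top {p : L} (hp : IsPrimeElement p) (x : L) :
    x ⇨ p = p ∨ x ⇨ p = ⊤ := by
  by_cases hx : x ≤ p
  · exact Or.inr (himp_eq_top_iff.2 hx)
  · exact Or.inl (hp.himp_eq hx)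

theorem le_sInf_primesAbove (a : L) : a ≤ sInf (primesAbove a) :=
  le_sInf fun _ hp => hp.2

theorem himp_sInf_eq (x : L) (A : Set L) : x ⇨ sInf A = sInf ((x ⇨ ·) '' A) := by
  refine eq_of_forall_le_iff fun c => ?_
  simp [le_himp_iff, le_sInf_iff]

/-- A covered prime of the form `x ⇨ a` occurs in every representation of `a` as a meet of
primes. -/
theorem IsCoveredPrime.mem_of_eq_sInf {a x : L} (hp : IsCoveredPrime (x ⇨ a)) {A : Set L}
    (hA : ∀ q ∈ A, IsPrimeElement q) (ha : a = sInf A) : x ⇨ a ∈ A := by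
  have h : x ⇨ a = sInf ((x ⇨ ·) '' A) := by rw [← himp_sInf_eq, ← ha]
  obtain ⟨q, hq, hqp⟩ := hp.2 _ h
  rcases (hA q hq).himp_eq_or_eq_top x with h' | h'
  · rwa [← hqp, show (fun y => x ⇨ y) q = q from h']
  · exact absurd (hqp.symm.trans h') hp.1

theorem IsAbsolutelyEssentialPrime.isEssentialPrime {p a : L}
    (h : IsAbsolutelyEssentialPrime p a) : IsEssentialPrime p a := by
  refine ⟨h.1, h.2.1, fun h' => h.2.2 (le_antisymm ?_ (le_sInf fun _ hq => hq.1.2))⟩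
  calc sInf (primesAbove a \ {p}) ≤ sInf (primesAbove a \ Set.Ici p) :=
        sInf_le_sInf (Set.sdiff_subset_sdiff_right (by simp))
    _ = a := h'

/-! ### Spatial frames -/

/-- A frame is spatial exactly when it has enough primes. -/
theorem isSpatial_iff : IsSpatial L ↔ ∀ a : L, a = sInf (primesAbove a) := by
  constructor
  · rintro ⟨X, _, ⟨e⟩⟩ a
    refine le_antisymm (le_sInf_primesAbove a) ?_
    rw [← e.le_iff_le]
    intro x hx
    by_contra hxa
    -- The prime attached to the point `x` is the largest open set not containing `x`.
    let U : TopologicalSpace.Opens X := ⟨(closure {x})ᶜ, isClosed_closure.isOpen_compl⟩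
    have hU : ∀ b : L, x ∉ e b ↔ b ≤ e.symm U := fun b => by
      rw [← e.le_iff_le, e.apply_symm_apply]
      constructor
      · intro hb y hy hyx
        obtain ⟨z, hz, rfl⟩ := mem_closure_iff.1 hyx _ (e b).isOpen hy
        exact hb hz
      · exact fun hb hxb => hb hxb (subset_closure rfl)
    have hprime : IsPrimeElement (e.symm U) := by
      refine ⟨fun h => (hU ⊤).2 h.ge (by rw [map_top]; trivial), fun y z hyz => ?_⟩
      have hx : x ∉ e (y ⊓ z) := (hU _).2 hyz.ge
      rw [map_inf] at hx
      by_cases hy : x ∈ e y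
      · exact Or.inr (le_antisymm (hyz.le.trans inf_le_right) ((hU z).1 fun hz => hx ⟨hy, hz⟩))
      · exact Or.inl (le_antisymm (hyz.le.trans inf_le_left) ((hU y).1 hy))
    exact (hU _).2 (sInf_le (show _ ∈ primesAbove a from ⟨hprime, (hU a).1 hxa⟩)) hx
  · intro h
    -- The primes of `L` form a space whose open sets are the sets `{p | ¬ a ≤ p}`.
    let D : L → Set {p : L // IsPrimeElement p} := fun a => {p | ¬ a ≤ p.1}
    let T : TopologicalSpace {p : L // IsPrimeElement p} :=
      { IsOpen := fun U => ∃ a, U = D a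
        isOpen_univ := ⟨⊤, by ext p; simpa [D] using p.2.1⟩
        isOpen_inter := by
          rintro _ _ ⟨a, rfl⟩ ⟨b, rfl⟩
          refine ⟨a ⊓ b, ?_⟩
          ext p
          simp only [D, Set.mem_inter_iff, Set.mem_ofPred_eq]
          rw [← le_himp_iff]
          constructor
          · rintro ⟨ha, hb⟩
            rwa [p.2.himp_eq hb]
          · exact fun hab => ⟨fun ha => hab (ha.trans le_himp),
              fun hb => hab (by rw [himp_eq_top_iff.2 hb]; exact le_top)⟩
        isOpen_sUnion := by
          intro S hS
          refine ⟨sSup {a | D a ∈ S}, ?_⟩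
          ext p
          simp only [Set.mem_sUnion, D, Set.mem_ofPred_eq, sSup_le_iff, not_forall]
          constructor
          · rintro ⟨U, hU, hp⟩
            obtain ⟨a, rfl⟩ := hS U hU
            exact ⟨a, hU, hp⟩
          · rintro ⟨a, ha, hp⟩
            exact ⟨_, ha, hp⟩ }
    let f : L → TopologicalSpace.Opens {p : L // IsPrimeElement p} := fun a => ⟨D a, a, rfl⟩
    have hf : ∀ a b, f a ≤ f b ↔ a ≤ b := fun a b => by
      constructor
      · intro hab
        rw [h b]
        refine le_sInf fun p hp => ?_
        by_contra hap
        exact hab (show (⟨p, hp.1⟩ : {p : L // IsPrimeElement p}) ∈ D a from hap) hp.2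
      · exact fun hab p hp hbp => hp (hab.trans hbp)
    refine ⟨_, T, ⟨OrderIso.ofSurjective (OrderEmbedding.ofMapLEIff f hf) ?_⟩⟩
    rintro ⟨_, a, rfl⟩
    exact ⟨a, rfl⟩

theorem isSpatial_orderIso {M N : Type u} [Order.Frame M] [Order.Frame N] (e : M ≃o N)
    (h : IsSpatial N) : IsSpatial M := by
  obtain ⟨X, _, ⟨g⟩⟩ := h
  exact ⟨X, _, ⟨e.trans g⟩⟩

theorem IsPrimeElement.isCoatom [ComplementedLattice L] {p : L} (hp : IsPrimeElement p) :
    IsCoatom p := by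
  refine ⟨hp.1, fun q hpq => ?_⟩
  obtain ⟨r, hr⟩ := exists_isCompl q
  have h : p = q ⊓ (p ⊔ r) := by
    rw [inf_sup_left, hr.inf_eq_bot, sup_bot_eq, inf_eq_right.2 hpq.le]
  rcases hp.2 _ _ h with h | h
  · exact absurd h hpq.ne
  · have hrq : r ≤ q := (le_sup_right.trans h.ge).trans hpq.le
    rw [← hr.sup_eq_top, sup_eq_left.2 hrq]

/-! ### Sublocales generated by an element or by covered primes -/

/-- The least sublocale containing `a`. -/
def principalSublocale (a : L) : Sublocale L where
  carrier := {c | ∃ x, x ⇨ a = c}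
  sInf_mem' A hA := by
    refine ⟨sSup {x | x ⇨ a ∈ A}, eq_of_forall_le_iff fun c => ?_⟩
    rw [le_himp_comm, sSup_le_iff, le_sInf_iff]
    constructor
    · intro h b hb
      obtain ⟨x, rfl⟩ := hA hb
      exact le_himp_comm.1 (h x hb)
    · exact fun h x hx => le_himp_comm.1 (h _ hx)
  himp_mem' := by
    rintro y _ ⟨x, rfl⟩
    exact ⟨y ⊓ x, himp_himp y x a |>.symm⟩

theorem mem_principalSublocale {a c : L} : c ∈ principalSublocale a ↔ ∃ x, x ⇨ a = c :=
  Iff.rfl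

theorem self_mem_principalSublocale (a : L) : a ∈ principalSublocale a :=
  ⟨⊤, top_himp⟩

theorem principalSublocale_le {a : L} {S : Sublocale L} : principalSublocale a ≤ S ↔ a ∈ S := by
  refine ⟨fun h => h (self_mem_principalSublocale a), ?_⟩
  rintro h _ ⟨x, rfl⟩
  exact S.himp_mem h

theorem mem_top_sublocale (a : L) : a ∈ (⊤ : Sublocale L) :=
  principalSublocale_le.1 le_top

theorem sublocale_ne_bot_iff {S : Sublocale L} : S ≠ ⊥ ↔ ∃ a ∈ S, a ≠ ⊤ := by
  constructor
  · intro h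
    by_contra! h'
    refine h (le_bot_iff.1 fun a ha => ?_)
    rw [h' a ha]
    exact Sublocale.top_mem
  · rintro ⟨a, ha, hne⟩ rfl
    obtain ⟨x, hx⟩ := (bot_le : ⊥ ≤ principalSublocale (⊤ : L)) ha
    exact hne (by rw [← hx, himp_top])

theorem IsPrimeElement.mem_principalSublocale {p : L} (hp : IsPrimeElement p) {c : L}
    (hc : c ∈ principalSublocale p) : c = p ∨ c = ⊤ := by
  obtain ⟨x, rfl⟩ := hc
  exact hp.himp_eq_or_eq_top x

/-- The sublocale of all meets of covered primes taken from `A`. -/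
def coveredSublocale (A : Set (ptD L)) : Sublocale L where
  carrier := {c | ∃ B ⊆ ((↑) '' A : Set L), sInf B = c}
  sInf_mem' C hC := by
    refine ⟨{p | p ∈ ((↑) '' A : Set L) ∧ sInf C ≤ p}, fun _ hp => hp.1,
      le_antisymm (le_sInf fun c hc => ?_) (le_sInf fun _ hp => hp.2)⟩
    obtain ⟨B, hB, rfl⟩ := hC hc
    exact sInf_le_sInf fun p hp => ⟨hB hp, (sInf_le hc).trans (sInf_le hp)⟩
  himp_mem' := by
    rintro x _ ⟨B, hB, rfl⟩
    have hprime : ∀ p ∈ B, IsPrimeElement p := fun p hp => by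
      obtain ⟨q, _, rfl⟩ := hB hp
      exact q.2.isPrimeElement
    refine ⟨{p ∈ B | ¬ x ≤ p}, fun p hp => hB hp.1, ?_⟩
    rw [himp_sInf_eq]
    refine le_antisymm (le_sInf ?_) (le_sInf fun p hp => ?_)
    · rintro _ ⟨p, hp, rfl⟩
      by_cases hx : x ≤ p
      · exact le_top.trans (himp_eq_top_iff.2 hx).ge
      · exact (sInf_le (show p ∈ {p ∈ B | ¬ x ≤ p} from ⟨hp, hx⟩)).trans le_himp
    · exact sInf_le ⟨p, hp.1, (hprime p hp.1).himp_eq hp.2⟩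

theorem mem_coveredSublocale {A : Set (ptD L)} {p : ptD L} :
    (p : L) ∈ coveredSublocale A ↔ p ∈ A := by
  constructor
  · rintro ⟨B, hB, h⟩
    obtain ⟨q, hq, hqp⟩ := hB (p.2.2 B h.symm)
    rwa [← Subtype.ext hqp]
  · exact fun hp => ⟨{(p : L)}, by simpa using hp, sInf_singleton⟩

/-! ### Primes of sublocales -/

theorem isPrimeElement_coe_iff {S : Sublocale L} {p : S} :
    IsPrimeElement (p : L) ↔ IsPrimeElement p := by
  have htop : (p : L) = ⊤ ↔ p = ⊤ := ⟨fun h => Subtype.ext h, fun h => congrArg Subtype.val h⟩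
  constructor
  · intro hp
    refine ⟨fun h => hp.1 (htop.2 h), fun x y h => ?_⟩
    exact (hp.2 x y (congrArg Subtype.val h)).imp Subtype.ext Subtype.ext
  · intro hp
    refine ⟨fun h => hp.1 (htop.1 h), fun x y h => ?_⟩
    have h' : p = S.restrict x ⊓ S.restrict y := by
      rw [← map_inf, ← h, Sublocale.restrict_of_mem p.2]
    refine (hp.2 _ _ h').imp (fun e => ?_) (fun e => ?_)
    · exact le_antisymm (h.le.trans inf_le_left) (S.giRestrict.gc.le_iff_le.1 e.ge)
    · exact le_antisymm (h.le.trans inf_le_right) (S.giRestrict.gc.le_iff_le.1 e.ge)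

theorem IsCoveredPrime.of_coe {S : Sublocale L} {p : S} (hp : IsCoveredPrime (p : L)) :
    IsCoveredPrime p := by
  refine ⟨fun h => hp.1 (congrArg Subtype.val h), fun A hA => ?_⟩
  obtain ⟨q, hq, hqp⟩ := hp.2 _ (congrArg Subtype.val hA)
  rwa [← Subtype.ext hqp]

/-- The frame `L` is isomorphic to its largest sublocale. -/
def topSublocaleIso (L : Type u) [Order.Frame L] : L ≃o (⊤ : Sublocale L) where
  toFun a := ⟨a, mem_top_sublocale a⟩
  invFun a := a
  left_inv _ := rfl
  right_inv _ := rfl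
  map_rel_iff' := Iff.rfl

theorem allPrimesCovered_of_top (h : AllPrimesCovered (⊤ : Sublocale L)) : AllPrimesCovered L := by
  intro p hp
  have hp' : IsCoveredPrime (⟨p, mem_top_sublocale p⟩ : (⊤ : Sublocale L)) :=
    h _ (isPrimeElement_coe_iff.1 hp)
  refine ⟨hp.1, fun A hA => ?_⟩
  refine hp'.2 (Subtype.val ⁻¹' A) (Subtype.ext ?_)
  rw [Sublocale.coe_sInf, Set.image_preimage_eq_of_subset]
  · exact hA
  · exact fun a _ => ⟨⟨a, mem_top_sublocale a⟩, rfl⟩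

/-! ### Essential primes and sublocales -/

/-- A prime that cannot be omitted from a binary meet belongs to each sublocale containing the meet,
because `m ⇨ (m ⊓ p) = p`. -/
theorem IsPrimeElement.mem_of_inf_mem {p m : L} (hp : IsPrimeElement p) {S : Sublocale L}
    (hS : m ⊓ p ∈ S) (hm : m ≠ m ⊓ p) : p ∈ S := by
  have hmp : ¬ m ≤ p := fun h => hm (inf_eq_left.2 h).symm
  have h : m ⇨ (m ⊓ p) ∈ S := S.himp_mem hS
  rwa [himp_inf_distrib, himp_self, top_inf_eq, hp.himp_eq hmp] at h

/-- A sublocale containing `a` contains every essential prime `p` of `a`, since `a` is the meet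
of `p` and the primes above `a` that are not above `p`. -/
theorem IsEssentialPrime.mem_of_mem {p a : L} (h : IsEssentialPrime p a) {S : Sublocale L}
    (hS : a ∈ S) : p ∈ S := by
  have ha : a = sInf (primesAbove a \ Set.Ici p) ⊓ p := by
    refine le_antisymm (le_inf (le_sInf fun q hq => hq.1.2) h.2.1.2) ?_
    conv_rhs => rw [h.1]
    refine le_sInf fun q hq => ?_
    by_cases hpq : p ≤ q
    · exact inf_le_right.trans hpq
    · exact inf_le_left.trans (sInf_le ⟨hq, hpq⟩)
  exact h.2.1.1.mem_of_inf_mem (ha ▸ hS) (fun hm => h.2.2 (hm.trans ha.symm))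

theorem IsCoveredPrime.isAbsolutelyEssentialPrime {p a : L} (hp : IsCoveredPrime p)
    (ha : a = sInf (primesAbove a)) (hpa : p ∈ principalSublocale a) :
    IsAbsolutelyEssentialPrime p a := by
  obtain ⟨x, rfl⟩ := hpa
  refine ⟨ha, ⟨hp.isPrimeElement, le_himp⟩, fun h => ?_⟩
  exact (hp.mem_of_eq_sInf (fun q hq => hq.1.1) h.symm).2 rfl

/-! ### Nonzero sublocales containing covered primes -/

/-- If every nonzero sublocale contains a covered prime, then each element is the meet of the
covered primes in the least sublocale containing it. -/
theorem eq_sInf_covered_mem_principalSublocale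
    (h : ∀ S : Sublocale L, S ≠ ⊥ → ∃ p ∈ S, IsCoveredPrime p) (a : L) :
    a = sInf {p | IsCoveredPrime p ∧ p ∈ principalSublocale a} := by
  set m := sInf {p | IsCoveredPrime p ∧ p ∈ principalSublocale a}
  refine le_antisymm (le_sInf ?_) ?_
  · rintro _ ⟨_, x, rfl⟩
    exact le_himp
  by_contra hm
  obtain ⟨p, ⟨x, hx⟩, hp⟩ := h (principalSublocale (m ⇨ a))
    (sublocale_ne_bot_iff.2 ⟨_, self_mem_principalSublocale _, mt himp_eq_top_iff.1 hm⟩)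
  rw [himp_himp] at hx
  have hpa : p ∈ {p | IsCoveredPrime p ∧ p ∈ principalSublocale a} := ⟨hp, _, hx⟩
  have hmp : m ≤ p := sInf_le hpa
  -- `m ≤ (x ⊓ m) ⇨ a` amounts to `x ⊓ m ≤ a`, that is, to `p = ⊤`.
  rw [← hx, le_himp_iff, inf_comm, inf_assoc, inf_idem, ← himp_eq_top_iff, hx] at hmp
  exact hp.1 hmp

theorem eq_sInf_primesAbove_of_sublocale
    (h : ∀ S : Sublocale L, S ≠ ⊥ → ∃ p ∈ S, IsCoveredPrime p) (a : L) :
    a = sInf (primesAbove a) := by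
  refine le_antisymm (le_sInf_primesAbove a) ?_
  conv_rhs => rw [eq_sInf_covered_mem_principalSublocale h a]
  refine sInf_le_sInf ?_
  rintro _ ⟨hp, x, rfl⟩
  exact ⟨hp.isPrimeElement, le_himp⟩

/-- If every nonzero sublocale contains a covered prime, then every sublocale is strongly
`T_D`-spatial: for a prime `p` the sublocale `{p, ⊤}` can only contain the covered prime `p`. -/
theorem isStronglyTDSpatial_of_sublocale
    (h : ∀ S : Sublocale L, S ≠ ⊥ → ∃ p ∈ S, IsCoveredPrime p) (S : Sublocale L) :
    IsStronglyTDSpatial S := by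
  constructor
  · refine isSpatial_iff.2 fun a => le_antisymm (le_sInf_primesAbove a) ?_
    rw [← Subtype.coe_le_coe, eq_sInf_covered_mem_principalSublocale h (a : L)]
    refine le_sInf ?_
    rintro _ ⟨hp, x, rfl⟩
    have hS : x ⇨ (a : L) ∈ S := S.himp_mem a.2
    have hp' : IsPrimeElement (⟨_, hS⟩ : S) := isPrimeElement_coe_iff.1 hp.isPrimeElement
    have hmem : (⟨_, hS⟩ : S) ∈ primesAbove a := ⟨hp', Subtype.coe_le_coe.1 le_himp⟩
    exact Subtype.coe_le_coe.2 (sInf_le hmem)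
  · intro p hp
    have hp' := isPrimeElement_coe_iff.2 hp
    obtain ⟨q, hq, hqc⟩ := h (principalSublocale (p : L))
      (sublocale_ne_bot_iff.2 ⟨_, self_mem_principalSublocale _, hp'.1⟩)
    rcases hp'.mem_principalSublocale hq with rfl | rfl
    · exact hqc.of_coe
    · exact absurd rfl hqc.1

theorem nonempty_orderIso_of_sublocale
    (h : ∀ S : Sublocale L, S ≠ ⊥ → ∃ p ∈ S, IsCoveredPrime p) :
    Nonempty (Sublocale L ≃o Set (ptD L)) := by
  let f : Sublocale L → Set (ptD L) := fun S => {p | (p : L) ∈ S}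
  have hf : ∀ S T, f S ≤ f T ↔ S ≤ T := fun S T => by
    refine ⟨fun hST a ha => ?_, fun hST p hp => hST hp⟩
    rw [eq_sInf_covered_mem_principalSublocale h a]
    refine T.sInf_mem ?_
    rintro p ⟨hp, hpa⟩
    exact hST (show (⟨p, hp⟩ : ptD L) ∈ f S from principalSublocale_le.2 ha hpa)
  exact ⟨OrderIso.ofSurjective (OrderEmbedding.ofMapLEIff f hf) fun A =>
    ⟨coveredSublocale A, Set.ext fun _ => mem_coveredSublocale⟩⟩

/-! ### Boolean coframes of sublocales -/

/-- In the dual frame, `S ≠ ⊥` lies below a prime, and primes of a Boolean frame are coatoms. -/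
theorem exists_isAtom_le_of_isSpatialCoframe [ComplementedLattice (Sublocale L)]
    (h : IsSpatialCoframe (Sublocale L)) {S : Sublocale L} (hS : S ≠ ⊥) :
    ∃ M ≤ S, IsAtom M := by
  have hS' := isSpatial_iff.1 h (OrderDual.toDual S)
  by_contra! hM
  have hempty : primesAbove (OrderDual.toDual S) = ∅ := by
    refine Set.eq_empty_of_forall_notMem fun M hp => ?_
    exact hM (OrderDual.ofDual M) hp.2 (isCoatom_dual_iff_isAtom.1 hp.1.isCoatom)
  rw [hempty, sInf_empty] at hS'
  exact hS hS'

/-- The part of a sublocale above an element `a` of `L`. -/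
def sublocaleAbove (S : Sublocale L) (a : L) : Sublocale L where
  carrier := {c | c ∈ S ∧ a ≤ c}
  sInf_mem' _ hA := ⟨S.sInf_mem fun _ hc => (hA hc).1, le_sInf fun _ hc => (hA hc).2⟩
  himp_mem' _ _ hb := ⟨S.himp_mem hb.1, hb.2.trans le_himp⟩

/-- An atom of the coframe of sublocales has exactly one element other than `⊤`. -/
theorem eq_or_eq_top_of_isAtom {M : Sublocale L} (hM : IsAtom M) {p : L} (hp : p ∈ M)
    (hne : p ≠ ⊤) {c : L} (hc : c ∈ M) : c = p ∨ c = ⊤ := by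
  -- Each element other than `⊤` of an atom is a least element of it.
  have least : ∀ q ∈ M, q ≠ ⊤ → ∀ c ∈ M, q ≤ c := fun q hq hqt c hc => by
    have hle : sublocaleAbove M q ≤ M := fun _ h => h.1
    have heq := (hM.le_iff.1 hle).resolve_left
      (sublocale_ne_bot_iff.2 ⟨q, ⟨hq, le_rfl⟩, hqt⟩)
    exact (heq.ge hc).2
  by_cases hct : c = ⊤
  · exact Or.inr hct
  · exact Or.inl (le_antisymm (least c hc hct p hp) (least p hp hne c hc))

theorem restrict_inf_restrict_of_codisjoint {M N : Sublocale L} (h : Codisjoint M N) (a : L) :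
    (M.restrict a : L) ⊓ N.restrict a = a := by
  have hle : (⊤ : Sublocale L) ≤ (M.toNucleus ⊓ N.toNucleus).toSublocale := by
    rw [← h.eq_top]
    refine sup_le ?_ ?_ <;> rw [← Sublocale.toNucleus_le_toNucleus] <;> intro x
    · simp
    · simp
  obtain ⟨x, hx⟩ := hle (mem_top_sublocale a)
  rw [← hx]
  exact (M.toNucleus ⊓ N.toNucleus).idempotent x

/-- The elements other than `⊤` of a complemented atom of the coframe of sublocales are covered
primes. -/
theorem isCoveredPrime_of_isAtom {M N : Sublocale L} (hM : IsAtom M) (hMN : IsCompl M N) {p : L}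
    (hp : p ∈ M) (hne : p ≠ ⊤) : IsCoveredPrime p := by
  have hpN : p ∉ N := fun hpN => by
    have hle : principalSublocale p ≤ ⊥ :=
      hMN.disjoint (principalSublocale_le.2 hp) (principalSublocale_le.2 hpN)
    exact sublocale_ne_bot_iff.2 ⟨p, self_mem_principalSublocale p, hne⟩ (le_bot_iff.1 hle)
  refine ⟨hne, fun A hA => by_contra fun hpA => hpN ?_⟩
  rw [hA]
  refine N.sInf_mem fun a ha => ?_
  -- The component of `a` in the atom `M = {p, ⊤}` is `p` only if `a = p`, so it is `⊤` here.
  have hdec := restrict_inf_restrict_of_codisjoint hMN.codisjoint a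
  rcases eq_or_eq_top_of_isAtom hM hp hne (M.restrict a).2 with h | h
  · have hap : a ≤ p := h ▸ M.giRestrict.gc.le_u_l a
    have hpa : p ≤ a := hA.le.trans (sInf_le ha)
    exact absurd (le_antisymm hpa hap ▸ ha) hpA
  · rw [h, top_inf_eq] at hdec
    exact hdec ▸ (N.restrict a).2

theorem isSpatialCoframe_of_orderIso_set {C X : Type u} [Order.Coframe C] (e : C ≃o Set X) :
    IsSpatialCoframe C := by
  let _ : TopologicalSpace X := ⊥
  have : DiscreteTopology X := ⟨rfl⟩
  let g : Set X ↪o TopologicalSpace.Opens X :=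
    OrderEmbedding.ofMapLEIff (fun U => ⟨U, isOpen_discrete U⟩) fun _ _ => Iff.rfl
  have hg : Function.Surjective g := fun U => ⟨U, rfl⟩
  exact ⟨X, ⊥, ⟨(e.dual.trans (OrderIso.compl (Set X)).symm).trans (OrderIso.ofSurjective g hg)⟩⟩

end FrameTD

theorem mainTheorem2 {L : Type*} [Order.Frame L] :
    List.TFAE [
      FrameTD.IsTotallySpatial L ∧ FrameTD.AllPrimesCovered L,
      FrameTD.IsTotallySpatial L ∧ FrameTD.IsStronglyTDSpatial L,
      ∀ S : Sublocale L, FrameTD.IsStronglyTDSpatial S,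
      Nonempty (Sublocale L ≃o Set (FrameTD.ptD L)),
      FrameTD.IsSpatialCoframe (Sublocale L) ∧ ComplementedLattice (Sublocale L),
      ∀ a : L, a = sInf {p | FrameTD.IsCoveredPrime p ∧ FrameTD.IsEssentialPrime p a},
      ∀ a : L, a = sInf {p | FrameTD.IsCoveredPrime p ∧ FrameTD.IsAbsolutelyEssentialPrime p a},
      FrameTD.IsSpatial L ∧ ∀ a : L, a ≠ ⊤ →
        ∃ p : L, FrameTD.IsCoveredPrime p ∧ FrameTD.IsAbsolutelyEssentialPrime p a,
      ∀ S : Sublocale L, S ≠ ⊥ → ∃ p ∈ S, FrameTD.IsCoveredPrime p] := by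
  tfae_have 1 → 9 := by
    rintro ⟨hsp, hcov⟩ S hS
    obtain ⟨a, ha, hne⟩ := FrameTD.sublocale_ne_bot_iff.1 hS
    have h := FrameTD.isSpatial_iff.1 (hsp S) ⟨a, ha⟩
    obtain ⟨p, hp⟩ : (FrameTD.primesAbove (⟨a, ha⟩ : S)).Nonempty := by
      refine Set.nonempty_iff_ne_empty.2 fun hempty => hne ?_
      rw [hempty, sInf_empty] at h
      exact congrArg Subtype.val h
    exact ⟨p, p.2, hcov p (FrameTD.isPrimeElement_coe_iff.2 hp.1)⟩
  tfae_have 9 → 3 := FrameTD.isStronglyTDSpatial_of_sublocale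
  tfae_have 3 → 2 := fun h => ⟨fun S => (h S).1,
    FrameTD.isSpatial_orderIso (FrameTD.topSublocaleIso L) (h ⊤).1,
    FrameTD.allPrimesCovered_of_top (h ⊤).2⟩
  tfae_have 2 → 1 := fun h => ⟨h.1, h.2.2⟩
  tfae_have 9 → 4 := FrameTD.nonempty_orderIso_of_sublocale
  tfae_have 4 → 5 := by
    rintro ⟨e⟩
    exact ⟨FrameTD.isSpatialCoframe_of_orderIso_set e, e.symm.complementedLattice⟩
  tfae_have 5 → 9 := by
    rintro ⟨hsp, _⟩ S hS
    obtain ⟨M, hMS, hM⟩ := FrameTD.exists_isAtom_le_of_isSpatialCoframe hsp hS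
    obtain ⟨N, hMN⟩ := exists_isCompl M
    obtain ⟨p, hp, hne⟩ := FrameTD.sublocale_ne_bot_iff.1 hM.1
    exact ⟨p, hMS hp, FrameTD.isCoveredPrime_of_isAtom hM hMN hp hne⟩
  tfae_have 9 → 7 := by
    intro h a
    refine le_antisymm (le_sInf fun p hp => hp.2.2.1.2) ?_
    conv_rhs => rw [FrameTD.eq_sInf_covered_mem_principalSublocale h a]
    exact sInf_le_sInf fun p hp => ⟨hp.1, hp.1.isAbsolutelyEssentialPrime
      (FrameTD.eq_sInf_primesAbove_of_sublocale h a) hp.2⟩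
  tfae_have 7 → 6 := by
    intro h a
    refine le_antisymm (le_sInf fun p hp => hp.2.2.1.2) ?_
    conv_rhs => rw [h a]
    exact sInf_le_sInf fun p hp => ⟨hp.1, hp.2.isEssentialPrime⟩
  tfae_have 6 → 9 := by
    intro h S hS
    obtain ⟨a, ha, hne⟩ := FrameTD.sublocale_ne_bot_iff.1 hS
    obtain ⟨p, hp⟩ :
        {p | FrameTD.IsCoveredPrime p ∧ FrameTD.IsEssentialPrime p a}.Nonempty := by
      refine Set.nonempty_iff_ne_empty.2 fun hempty => hne ?_
      rw [h a, hempty, sInf_empty]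
    exact ⟨p, hp.2.mem_of_mem ha, hp.1⟩
  tfae_have 7 → 8 := by
    intro h
    constructor
    · refine FrameTD.isSpatial_iff.2 fun a => le_antisymm (FrameTD.le_sInf_primesAbove a) ?_
      conv_rhs => rw [h a]
      exact sInf_le_sInf fun p hp => hp.2.2.1
    · intro a hne
      by_contra! hempty
      refine hne (top_le_iff.1 ?_)
      rw [h a]
      exact le_sInf fun p hp => absurd hp.2 (hempty p hp.1)
  tfae_have 8 → 9 := by
    rintro ⟨_, h⟩ S hS
    obtain ⟨a, ha, hne⟩ := FrameTD.sublocale_ne_bot_iff.1 hS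
    obtain ⟨p, hp, hpa⟩ := h a hne
    exact ⟨p, hpa.isEssentialPrime.mem_of_mem ha, hp⟩
  tfae_finish
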